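/- Let $(X,d)$ be a complete separable metric space with its Borel $\sigma$-algebra, let $m=(m_x)_{x\in X}$ be a family of Borel probability measures on $X$ such that $x\mapsto m_x(A)$ is Borel for every Borel set $A$, and let $\nu$ be a $\sigma$-finite Borel measure on $X$ that is reversible for $m$, i.e. $\int_A m_x(B)\,d\nu(x)=\int_B m_x(A)\,d\nu(x)$ for all Borel sets $A,B\subset X$. (In particular this covers every $m$-connected metric random walk space with a $\sigma$-finite invariant and reversible Radon measure $\nu$.) Let $\nu\otimes m_x$ be the measure on $X\times X$ with $(\nu\otimes m_x)(U)=\int_X\int_X\chi_U(x,y)\,dm_x(y)\,d\nu(x)$. For $u\in L^2(X,\nu)$ put $$\mathcal F_m(u)=\frac12\int_X\int_X|u(y)-u(x)|\,dm_x(y)\,d\nu(x)\in[0,+\infty],$$ that is, $\mathcal F_m(u)$ is the $m$-total variation $TV_m(u)$ if this integral is finite and $+\infty$ otherwise. Let $\partial\mathcal F_m(u)$ be the set of $v\in L^2(X,\nu)$ with $\mathcal F_m(w)\ge\mathcal F_m(u)+\int_X v(w-u)\,d\nu$ for all $w\in L^2(X,\nu)$. Write $\nabla u(x,y)=u(y)-u(x)$;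 for $\mathbf z:X\times X\to\mathbb R$ let $({\rm div}_m\mathbf z)(x)=\frac12\int_X(\mathbf z(x,y)-\mathbf z(y,x))\,dm_x(y)$, and let $X_m^2(X)$ be the set of $\mathbf z\in L^\infty(X\times X,\nu\otimes m_x)$ with ${\rm div}_m\mathbf z\in L^2(X,\nu)$. Let ${\rm sign}(r)=\{1\}$ for $r>0$, $\{-1\}$ for $r<0$ and $[-1,1]$ for $r=0$. A function $\mathbf g\in L^\infty(X\times X,\nu\otimes m_x)$ is antisymmetric if $\mathbf g(y,x)=-\mathbf g(x,y)$ for $(\nu\otimes m_x)$-a.e. $(x,y)$. Write $\|\cdot\|_\infty$ for the norm of $L^\infty(X\times X,\nu\otimes m_x)$. **Theorem.** For all $u,v\in L^2(X,\nu)$ the following assertions are equivalent: (i) $v\in\partial\mathcal F_m(u)$; (ii) there is $\mathbf z\in X_m^2(X)$ with $\|\mathbf z\|_\infty\le1$ such that $v=-{\rm div}_m\mathbf z$ $\nu$-a.e. and $\int_X u\,v\,d\nu=\mathcal F_m(u)$; (iii) there is $\mathbf z\in X_m^2(X)$ with $\|\mathbf z\|_\infty\le1$ such that $v=-{\rm div}_m\mathbf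 z$ $\nu$-a.e. and $\mathcal F_m(u)=\frac12\int_{X\times X}\nabla u(x,y)\,\mathbf z(x,y)\,d(\nu\otimes m_x)(x,y)$; (iv) there is an antisymmetric $\mathbf g\in L^\infty(X\times X,\nu\otimes m_x)$ with $\|\mathbf g\|_\infty\le1$ such that $-\int_X\mathbf g(x,y)\,dm_x(y)=v(x)$ for $\nu$-a.e. $x\in X$ and $-\int_X\int_X\mathbf g(x,y)\,dm_x(y)\,u(x)\,d\nu(x)=\mathcal F_m(u)$; (v) there is an antisymmetric $\mathbf g\in L^\infty(X\times X,\nu\otimes m_x)$ with $\|\mathbf g\|_\infty\le1$ such that $-\int_X\mathbf g(x,y)\,dm_x(y)=v(x)$ for $\nu$-a.e. $x\in X$ and $\mathbf g(x,y)\in{\rm sign}(u(y)-u(x))$ for $(\nu\otimes m_x)$-a.e. $(x,y)\in X\times X$. -/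

import Mathlib

open MeasureTheory ProbabilityTheory
open scoped ENNReal

noncomputable section

namespace RandomWalkTV

/-- The subdifferential at `u` of an extended-real-valued functional on a real Hilbert space. -/
def subdifferential {H : Type*} [NormedAddCommGroup H] [InnerProductSpace ℝ H]
    (Φ : H → EReal) (u : H) : Set H :=
  {v | ∀ w : H, Φ u + ((inner ℝ v (w - u) : ℝ) : EReal) ≤ Φ w}

/-- The multivalued sign: `{1}` for `r > 0`, `{-1}` for `r < 0`, and `[-1, 1]` for `r = 0`. -/
def multiSign (r : ℝ) : Set ℝ :=
  if 0 < r then {1} else if r < 0 then {-1} else Set.Icc (-1) 1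

/-- The nonlocal gradient `(x, y) ↦ u y - u x`. -/
def grad {X : Type*} (u : X → ℝ) (p : X × X) : ℝ := u p.2 - u p.1

variable {X : Type*} [MeasurableSpace X]

/-- The `m`-total variation `(1/2) ∫ ∫ |u y - u x| dm_x(y) dν(x)`, with values in `[0, ∞]`.
A measurable function belongs to the space `BV_m` exactly when this is finite. -/
def totalVariation (m : Kernel X X) (ν : Measure X) (u : X → ℝ) : ℝ≥0∞ :=
  2⁻¹ * ∫⁻ x, ∫⁻ y, ENNReal.ofReal |u y - u x| ∂(m x) ∂ν

/-- The functional on `L²(X, ν)` equal to the `m`-total variation on `L² ∩ BV_m` and to `+∞`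
on `L² \ BV_m`. -/
def energy (m : Kernel X X) (ν : Measure X) (u : Lp ℝ 2 ν) : EReal :=
  ((totalVariation m ν u : ℝ≥0∞) : EReal)

/-- The `m`-divergence `(1/2) ∫ (z(x, y) - z(y, x)) dm_x(y)`. -/
def divergence (m : Kernel X X) (z : X × X → ℝ) (x : X) : ℝ :=
  (1 / 2) * ∫ y, (z (x, y) - z (y, x)) ∂(m x)

/-- `z ∈ X_m^p(X)`: `z` is in `L^∞(ν ⊗ m_x)` and its `m`-divergence is in `L^p(ν)`. -/
def MemVectorField (m : Kernel X X) (ν : Measure X) (p : ℝ≥0∞) (z : X × X → ℝ) : Prop :=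
  MemLp z ∞ (ν ⊗ₘ m) ∧ MemLp (divergence m z) p ν

/-- Antisymmetry of (the class of) a function in `L^∞(ν ⊗ m_x)`. -/
def IsAntisymmetric (m : Kernel X X) (ν : Measure X) (g : X × X → ℝ) : Prop :=
  ∀ᵐ p ∂(ν ⊗ₘ m), g (p.2, p.1) = - g p

end RandomWalkTV

end

namespace RandomWalkTV

/-! ### Reversibility as swap invariance of `ν ⊗ₘ m`. -/

section Reversible

variable {X : Type*} [MeasurableSpace X] {m : Kernel X X} [IsMarkovKernel m]
  {ν : Measure X} [SigmaFinite ν]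

/-! The energy is half the L¹ norm of `grad u` for `ν ⊗ₘ m`, a measure that reversibility makes
invariant under the swap. Being convex and positively homogeneous, it has v as a subgradient at u
exactly when ⟨v, w⟩ ≤ energy w for all w, with equality at w = u; `of_mem_subdifferential_energy`
extracts these two facts. The inequality says that w ↦ ⟨v, w⟩ factors through `grad` with norm at
most 1/2. Hahn-Banach and the duality of L¹ and L^∞ (`exists_bounded_representation`) then give a
field z with |z| ≤ 1 and v = -div z (`exists_divergence_eq`).

Conversely, Green's formula (`integral_grad_mul`) turns ⟨v, w⟩ into half the integral of z grad w,
which is at most the energy. Antisymmetrizing z changes neither its divergence nor its bound, and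
⟨v, u⟩ = energy u is the equality case of g grad u ≤ |grad u|, that is, the sign condition.

The delicate point is integrability, since ν may be infinite. Soft thresholding sends L² into L¹ and
is monotone and 1-Lipschitz. It yields Green's formula for L² functions of finite energy and, with
Fatou, the finiteness of the energy, which (v) does not assume (`integrable_grad_of_mul_eq_abs`). -/

lemma sigmaFinite_compProd (m : Kernel X X) [IsMarkovKernel m] (ν : Measure X) [SigmaFinite ν] :
    SigmaFinite (ν ⊗ₘ m) := by
  refine SigmaFinite.of_map _ measurable_fst.aemeasurable ?_
  have h := Measure.fst_compProd ν m
  rw [Measure.fst] at h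
  rw [h]
  infer_instance

lemma measurePreserving_fst_compProd (m : Kernel X X) [IsMarkovKernel m] (ν : Measure X)
    [SigmaFinite ν] : MeasurePreserving Prod.fst (ν ⊗ₘ m) ν :=
  ⟨measurable_fst, Measure.fst_compProd ν m⟩

/-- Reversibility means that `ν ⊗ₘ m` is invariant under exchange of the coordinates. -/
lemma measurePreserving_swap_compProd (hν : m.IsReversible ν) :
    MeasurePreserving Prod.swap (ν ⊗ₘ m) (ν ⊗ₘ m) := by
  refine ⟨measurable_swap, ?_⟩
  have hrect : ∀ {s t : Set X}, MeasurableSet s → MeasurableSet t →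
      (ν ⊗ₘ m) (s ×ˢ t) = ((ν ⊗ₘ m).map Prod.swap) (s ×ˢ t) := by
    intro s t hs ht
    rw [Measure.map_apply measurable_swap (hs.prod ht), Set.preimage_swap_prod,
      Measure.compProd_apply_prod hs ht, Measure.compProd_apply_prod ht hs, hν hs ht]
  -- Agreement on the π-system of rectangles suffices once rectangles of finite measure exhaust the
  -- space; each strip below has measure ν(Sₙ) because m is Markov.
  let S : (ν ⊗ₘ m).FiniteSpanningSetsIn
      (Set.image2 (· ×ˢ ·) {s : Set X | MeasurableSet s} {t : Set X | MeasurableSet t}) :=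
    { set := fun n => spanningSets ν n ×ˢ Set.univ
      set_mem := fun n => ⟨_, measurableSet_spanningSets ν n, _, MeasurableSet.univ, rfl⟩
      finite := fun n => by
        rw [Measure.compProd_apply_prod (measurableSet_spanningSets ν n) MeasurableSet.univ]
        simpa using measure_spanningSets_lt_top ν n
      spanning := by
        rw [← Set.iUnion_prod_const, iUnion_spanningSets, Set.univ_prod_univ] }
  refine (S.ext generateFrom_prod.symm isPiSystem_prod ?_).symm
  rintro _ ⟨s, hs, t, ht, rfl⟩
  exact hrect hs ht

lemma measurePreserving_snd_compProd (hν : m.IsReversible ν) :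
    MeasurePreserving Prod.snd (ν ⊗ₘ m) ν :=
  (measurePreserving_fst_compProd m ν).comp (measurePreserving_swap_compProd hν)

end Reversible

/-! ### Soft thresholding, from L² into L¹. -/

section Threshold

/-- Soft thresholding at level `ε`. -/
noncomputable def softThreshold (ε x : ℝ) : ℝ := x - max (-ε) (min x ε)

lemma continuous_softThreshold (ε : ℝ) : Continuous (softThreshold ε) := by
  unfold softThreshold; fun_prop

lemma abs_softThreshold_le {ε : ℝ} (hε : 0 < ε) (x : ℝ) : |softThreshold ε x| ≤ |x| := by
  unfold softThreshold
  grind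

/-- The threshold vanishes for |x| ≤ ε, and |x| ≤ x²/ε beyond. This makes thresholded L² functions
integrable. -/
lemma abs_softThreshold_le_sq {ε : ℝ} (hε : 0 < ε) (x : ℝ) :
    |softThreshold ε x| ≤ ε⁻¹ * x ^ 2 := by
  rcases le_or_gt |x| ε with h | h
  · have : softThreshold ε x = 0 := by unfold softThreshold; grind
    rw [this, abs_zero]; positivity
  · refine (abs_softThreshold_le hε x).trans ?_
    rw [← sq_abs x, inv_mul_eq_div, le_div_iff₀ hε]
    nlinarith [abs_nonneg x]

lemma abs_softThreshold_sub_self_le {ε : ℝ} (hε : 0 < ε) (x : ℝ) :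
    |softThreshold ε x - x| ≤ ε := by
  unfold softThreshold
  grind

lemma softThreshold_mono {ε : ℝ} (hε : 0 < ε) {x y : ℝ} (h : x ≤ y) :
    softThreshold ε x ≤ softThreshold ε y := by
  unfold softThreshold
  grind

lemma abs_softThreshold_sub_le {ε : ℝ} (hε : 0 < ε) (x y : ℝ) :
    |softThreshold ε y - softThreshold ε x| ≤ |y - x| := by
  unfold softThreshold
  grind

lemma tendsto_softThreshold (x : ℝ) :
    Filter.Tendsto (fun n : ℕ => softThreshold (1 / ((n : ℝ) + 1)) x) Filter.atTop (nhds x) := by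
  rw [tendsto_iff_norm_sub_tendsto_zero]
  exact squeeze_zero (fun _ => norm_nonneg _)
    (fun n => abs_softThreshold_sub_self_le Nat.one_div_pos_of_nat x)
    tendsto_one_div_add_atTop_nhds_zero_nat

variable {X : Type*} [MeasurableSpace X] {ν : Measure X}

lemma integrable_softThreshold {ε : ℝ} (hε : 0 < ε) {w : X → ℝ} (hw : MemLp w 2 ν) :
    Integrable (fun x => softThreshold ε (w x)) ν := by
  refine (hw.integrable_sq.const_mul ε⁻¹).mono'
    ((continuous_softThreshold ε).comp_aestronglyMeasurable hw.1)
    (.of_forall fun x => abs_softThreshold_le_sq hε (w x))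

lemma tendsto_integral_mul_softThreshold {v w : X → ℝ} (hv : MemLp v 2 ν) (hw : MemLp w 2 ν) :
    Filter.Tendsto (fun n : ℕ => ∫ x, softThreshold (1 / ((n : ℝ) + 1)) (w x) * v x ∂ν)
      Filter.atTop (nhds (∫ x, w x * v x ∂ν)) := by
  refine tendsto_integral_of_dominated_convergence (fun x => |w x * v x|)
    (fun n => ((continuous_softThreshold _).comp_aestronglyMeasurable hw.1).mul hv.1)
    (hw.integrable_mul hv).abs (fun n => .of_forall fun x => ?_) (.of_forall fun x => ?_)
  · rw [Real.norm_eq_abs, abs_mul, abs_mul]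
    exact mul_le_mul_of_nonneg_right (abs_softThreshold_le Nat.one_div_pos_of_nat _) (abs_nonneg _)
  · exact (tendsto_softThreshold (w x)).mul_const _

end Threshold

/-! ### The dual of L¹ of a σ-finite measure. -/

section Dual

variable {Y : Type*} [MeasurableSpace Y] {μ : Measure Y}

lemma exists_pos_memLp_two (μ : Measure Y) [SigmaFinite μ] :
    ∃ h : Y → ℝ, Measurable h ∧ (∀ y, 0 < h y) ∧ MemLp h 2 μ := by
  obtain ⟨k, hpos, hmeas, hint⟩ :=
    exists_pos_lintegral_lt_of_sigmaFinite μ (ε := 1) one_ne_zero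
  refine ⟨fun y => Real.sqrt (k y), by fun_prop, fun y => Real.sqrt_pos.2 (hpos y), ?_⟩
  rw [memLp_two_iff_integrable_sq (by fun_prop)]
  simp only [Real.sq_sqrt NNReal.zero_le_coe]
  refine ⟨by fun_prop, ?_⟩
  simpa [HasFiniteIntegral] using hint.trans ENNReal.one_lt_top

/-- A bounded functional on `L¹` of a σ-finite measure is integration against a bounded function. -/
theorem exists_bounded_representation [SigmaFinite μ] (ℓ : Lp ℝ 1 μ →L[ℝ] ℝ) {C : ℝ}
    (hℓ : ‖ℓ‖ ≤ C) :
    ∃ g : Y → ℝ, AEStronglyMeasurable g μ ∧ (∀ᵐ y ∂μ, |g y| ≤ C) ∧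
      ∀ (f : Y → ℝ) (hf : Integrable f μ), ℓ hf.toL1 = ∫ y, f y * g y ∂μ := by
  obtain ⟨h, hmeas, hpos, hh⟩ := exists_pos_memLp_two μ
  -- Multiplication by h maps L² into L¹; pulling ℓ back along it allows Riesz representation in a
  -- Hilbert space, and the density sought is k / h.
  let T : Lp ℝ 2 μ →L[ℝ] Lp ℝ 1 μ :=
    ContinuousLinearMap.holderL μ 2 2 1 (ContinuousLinearMap.mul ℝ ℝ) hh.toLp
  have hT : ∀ φ : Lp ℝ 2 μ, T φ =ᵐ[μ] fun y => h y * φ y := by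
    intro φ
    have h1 : T φ =ᵐ[μ] fun y => MemLp.toLp h hh y * φ y :=
      ContinuousLinearMap.coeFn_holder (ContinuousLinearMap.mul ℝ ℝ) hh.toLp φ
    filter_upwards [h1, hh.coeFn_toLp] with y h1 h2
    rw [h1, h2]
  let k : Lp ℝ 2 μ := (InnerProductSpace.toDual ℝ (Lp ℝ 2 μ)).symm (ℓ ∘L T)
  have hk : ∀ φ : Lp ℝ 2 μ, ℓ (T φ) = ∫ y, φ y * k y ∂μ := by
    intro φ
    have : inner ℝ k φ = (ℓ ∘L T) φ := InnerProductSpace.toDual_symm_apply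
    rw [L2.inner_def] at this
    simpa using this.symm
  have hrep : ∀ (φ : Y → ℝ), MemLp φ 2 μ → ∀ hf : Integrable (fun y => h y * φ y) μ,
      ℓ hf.toL1 = ∫ y, φ y * k y ∂μ := by
    intro φ hφ hf
    have h1 : hf.toL1 = T hφ.toLp := by
      refine Lp.ext ?_
      filter_upwards [hf.coeFn_toL1, hT hφ.toLp, hφ.coeFn_toLp] with y h1 h2 h3
      rw [h1, h2, h3]
    rw [h1, hk]
    refine integral_congr_ae ?_
    filter_upwards [hφ.coeFn_toLp] with y h3
    rw [h3]
  have hbound : ∀ (f : Y → ℝ) (hf : Integrable f μ), ℓ hf.toL1 ≤ C * ∫ y, |f y| ∂μ := by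
    intro f hf
    refine (le_abs_self _).trans ((ℓ.le_opNorm _).trans ?_)
    rw [L1.norm_of_fun_eq_integral_norm]
    exact mul_le_mul_of_nonneg_right hℓ (integral_nonneg fun _ => norm_nonneg _)
  have hkL : MemLp k 2 μ := Lp.memLp k
  have hkb : ∀ᵐ y ∂μ, |k y| ≤ C * h y := by
    have hCh : MemLp (fun y => C * h y) 2 μ := hh.const_mul C
    have hC : 0 ≤ C := (norm_nonneg _).trans hℓ
    -- Test with the excess of k over the desired bound C h: then ψ k dominates C |h ψ| + ψ², while
    -- the bound on ℓ gives ∫ ψ k ≤ C ∫ |h ψ|, so ψ = 0 almost everywhere.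
    let ψ : Y → ℝ := fun y => softThreshold (C * h y) (k y)
    have hψm : AEStronglyMeasurable ψ μ := by
      have h1 := hkL.1.aemeasurable
      refine AEMeasurable.aestronglyMeasurable ?_
      unfold ψ softThreshold
      fun_prop
    have hψL : MemLp ψ 2 μ := by
      refine hkL.mono hψm (.of_forall fun y => ?_)
      have : 0 ≤ C * h y := mul_nonneg hC (hpos y).le
      simp only [ψ, Real.norm_eq_abs]
      unfold softThreshold
      grind
    have hint : Integrable (fun y => h y * ψ y) μ := hh.integrable_mul hψL
    have h1 := hbound _ hint
    rw [hrep ψ hψL hint, ← integral_const_mul] at h1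
    have hψk : Integrable (fun y => ψ y * k y) μ := hψL.integrable_mul hkL
    have hpt : ∀ y, C * |h y * ψ y| + ψ y ^ 2 ≤ ψ y * k y := by
      intro y
      have h0 : 0 ≤ C * h y := mul_nonneg hC (hpos y).le
      rw [abs_mul, abs_of_pos (hpos y), ← mul_assoc]
      generalize hc : C * h y = c at h0
      have : ψ y = softThreshold c (k y) := by simp only [ψ, hc]
      rw [this]
      generalize k y = t
      unfold softThreshold
      rcases le_total |t| c with hle | hle
      · have h2 : t - max (-c) (min t c) = 0 := by grind
        simp [h2]
      · rcases le_total 0 t with ht | ht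
        · rw [abs_of_nonneg ht] at hle
          rw [min_eq_right hle, max_eq_right (by linarith), abs_of_nonneg (by linarith)]
          nlinarith
        · rw [abs_of_nonpos ht] at hle
          rw [min_eq_left (by linarith), max_eq_left (by linarith), abs_of_nonpos (by linarith)]
          nlinarith
    have h2 : ∫ y, C * |h y * ψ y| ∂μ + ∫ y, ψ y ^ 2 ∂μ ≤ ∫ y, ψ y * k y ∂μ := by
      rw [← integral_add (hint.abs.const_mul C) hψL.integrable_sq]
      exact integral_mono ((hint.abs.const_mul C).add hψL.integrable_sq) hψk hpt
    have h3 : ∫ y, ψ y ^ 2 ∂μ = 0 :=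
      le_antisymm (by linarith) (integral_nonneg fun _ => sq_nonneg _)
    rw [integral_eq_zero_iff_of_nonneg (fun _ => sq_nonneg _) hψL.integrable_sq] at h3
    filter_upwards [h3] with y hy
    have hy' : softThreshold (C * h y) (k y) = 0 := by simpa [ψ] using hy
    have : 0 ≤ C * h y := mul_nonneg hC (hpos y).le
    unfold softThreshold at hy'
    grind
  have hgm : AEStronglyMeasurable (fun y => k y / h y) μ :=
    (hkL.1.aemeasurable.div hmeas.aemeasurable).aestronglyMeasurable
  have hgb : ∀ᵐ y ∂μ, |k y / h y| ≤ C := by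
    filter_upwards [hkb] with y hy
    rwa [abs_div, abs_of_pos (hpos y), div_le_iff₀ (hpos y)]
  refine ⟨fun y => k y / h y, hgm, hgb, fun f hf => ?_⟩
  -- approximate `f` by its restriction to `{|f| ≤ n h²}`, where `f / h` is square integrable
  obtain ⟨f', hf'm, hff'⟩ := hf.1
  have hf' : Integrable f' μ := hf.congr hff'
  have heq : hf.toL1 = hf'.toL1 := (Integrable.toL1_eq_toL1_iff _ _ _ _).2 hff'
  have hint_eq : ∫ y, f y * (k y / h y) ∂μ = ∫ y, f' y * (k y / h y) ∂μ :=
    integral_congr_ae (by filter_upwards [hff'] with y hy; rw [hy])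
  rw [heq, hint_eq]
  let A : ℕ → Set Y := fun n => {y | |f' y| ≤ n * h y ^ 2}
  have hAm : ∀ n, MeasurableSet (A n) := fun n =>
    measurableSet_le hf'm.measurable.abs (by fun_prop)
  have hAev : ∀ y, ∀ᶠ n in Filter.atTop, y ∈ A n := by
    intro y
    obtain ⟨N, hN⟩ := exists_nat_ge (|f' y| / h y ^ 2)
    filter_upwards [Filter.eventually_ge_atTop N] with n hn
    have h2 : 0 < h y ^ 2 := pow_pos (hpos y) 2
    rw [div_le_iff₀ h2] at hN
    exact hN.trans (mul_le_mul_of_nonneg_right (by exact_mod_cast hn) h2.le)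
  have hfn : ∀ n, Integrable ((A n).indicator f') μ := fun n => hf'.indicator (hAm n)
  have hlim : Filter.Tendsto (fun n => (hfn n).toL1) Filter.atTop (nhds hf'.toL1) := by
    rw [tendsto_iff_norm_sub_tendsto_zero]
    have h1 : ∀ n, ‖(hfn n).toL1 - hf'.toL1‖ = ∫ y, ‖(A n).indicator f' y - f' y‖ ∂μ := by
      intro n
      rw [← Integrable.toL1_sub, L1.norm_of_fun_eq_integral_norm]
      rfl
    simp only [h1]
    rw [← integral_zero Y ℝ (μ := μ)]
    refine tendsto_integral_of_dominated_convergence (fun y => |f' y|)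
      (fun n => ((hfn n).sub hf').norm.1) hf'.abs (fun n => .of_forall fun y => ?_)
      (.of_forall fun y => ?_)
    · by_cases hy : y ∈ A n <;> simp [hy]
    · refine tendsto_const_nhds.congr' ?_
      filter_upwards [hAev y] with n hn
      simp [hn]
  refine tendsto_nhds_unique ((ℓ.continuous.tendsto _).comp hlim) ?_
  have hval : ∀ n, ℓ (hfn n).toL1 = ∫ y, (A n).indicator f' y * (k y / h y) ∂μ := by
    intro n
    have hφ : MemLp (fun y => (A n).indicator f' y / h y) 2 μ := by
      refine (hh.const_mul (n : ℝ)).mono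
        (((hf'm.measurable.indicator (hAm n)).div hmeas).aestronglyMeasurable)
        (.of_forall fun y => ?_)
      have hy0 := hpos y
      rw [Real.norm_eq_abs, Real.norm_eq_abs, abs_div, abs_of_pos hy0,
        abs_of_nonneg (mul_nonneg n.cast_nonneg hy0.le), div_le_iff₀ hy0]
      by_cases hy : y ∈ A n
      · have : |f' y| ≤ n * h y ^ 2 := hy
        simp only [hy, Set.indicator_of_mem]
        nlinarith
      · simp only [hy, not_false_eq_true, Set.indicator_of_notMem, abs_zero]
        positivity
    have hfun : (A n).indicator f' = fun y => h y * ((A n).indicator f' y / h y) := by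
      funext y
      rw [mul_div_cancel₀ _ (hpos y).ne']
    have hi : Integrable (fun y => h y * ((A n).indicator f' y / h y)) μ := by
      rw [← hfun]; exact hfn n
    have : (hfn n).toL1 = hi.toL1 :=
      (Integrable.toL1_eq_toL1_iff _ _ _ _).2 (.of_forall fun y => congrFun hfun y)
    rw [this, hrep _ hφ hi]
    refine integral_congr_ae (.of_forall fun y => ?_)
    ring
  change Filter.Tendsto (fun n => ℓ (hfn n).toL1) _ _
  simp only [hval]
  refine tendsto_integral_of_dominated_convergence (fun y => C * |f' y|)
    (fun n => (hfn n).1.mul hgm) (hf'.abs.const_mul C) (fun n => ?_) (.of_forall fun y => ?_)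
  · filter_upwards [hgb] with y hy
    rw [Real.norm_eq_abs, abs_mul, mul_comm]
    refine mul_le_mul hy ?_ (abs_nonneg _) ((abs_nonneg _).trans hy)
    by_cases hyA : y ∈ A n <;> simp [hyA]
  · refine tendsto_const_nhds.congr' ?_
    filter_upwards [hAev y] with n hn
    simp [hn]

end Dual

end RandomWalkTV

/-! ### Unit-ball and sign conditions. -/

namespace RandomWalkTV

lemma memLp_top_and_eLpNorm_le_one_iff {Y : Type*} [MeasurableSpace Y] {μ : Measure Y}
    {z : Y → ℝ} :
    (MemLp z ∞ μ ∧ eLpNorm z ∞ μ ≤ 1) ↔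
      AEStronglyMeasurable z μ ∧ ∀ᵐ p ∂μ, ‖z p‖ ≤ 1 := by
  constructor
  · rintro ⟨h, h1⟩
    refine ⟨h.1, ?_⟩
    filter_upwards [ae_le_eLpNormEssSup (f := z) (μ := μ)] with p hp
    rw [eLpNorm_exponent_top] at h1
    have h2 : ‖z p‖ₑ ≤ ‖(1 : ℝ)‖ₑ := by simpa using hp.trans h1
    simpa using enorm_le_iff_norm_le.1 h2
  · rintro ⟨h, h1⟩
    exact ⟨memLp_top_of_bound h 1 h1, by
      simpa using eLpNormEssSup_le_of_ae_bound h1⟩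

/-- Membership in the sign is the equality case of r a ≤ |r| for |a| ≤ 1, the form that integration
can detect. -/
lemma mem_multiSign_iff {a r : ℝ} : a ∈ multiSign r ↔ ‖a‖ ≤ 1 ∧ r * a = |r| := by
  unfold multiSign
  rcases lt_trichotomy r 0 with h | rfl | h
  · rw [if_neg h.not_gt, if_pos h, abs_of_neg h, show -r = r * -1 by ring,
      mul_right_inj' h.ne]
    simp +contextual
  · simp [abs_le]
  · rw [if_pos h, abs_of_pos h, mul_eq_left₀ h.ne']
    simp +contextual

variable {X : Type*} [MeasurableSpace X] {m : Kernel X X} [IsMarkovKernel m]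
  {ν : Measure X} [SigmaFinite ν]

/-! ### The energy as an L¹ norm of the gradient. -/

section Energy

lemma measurable_grad {w : X → ℝ} (hw : Measurable w) : Measurable (grad w) := by
  unfold grad; fun_prop

lemma totalVariation_eq_lintegral_grad {w : X → ℝ} (hw : Measurable w) :
    totalVariation m ν w = 2⁻¹ * ∫⁻ p, ‖grad w p‖ₑ ∂(ν ⊗ₘ m) := by
  rw [Measure.lintegral_compProd (measurable_grad hw).enorm]
  simp [totalVariation, grad, Real.enorm_eq_ofReal_abs]

lemma energy_of_integrable_grad {u : Lp ℝ 2 ν} (h : Integrable (grad u) (ν ⊗ₘ m)) :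
    energy m ν u = (((1 / 2) * ∫ p, |grad u p| ∂(ν ⊗ₘ m) : ℝ) : EReal) := by
  rw [energy, totalVariation_eq_lintegral_grad (Lp.stronglyMeasurable u).measurable,
    ← ofReal_integral_norm_eq_lintegral_enorm h]
  have h2 : (2⁻¹ : ℝ≥0∞) = ENNReal.ofReal (1 / 2) := by
    rw [one_div, ENNReal.ofReal_inv_of_pos two_pos]; simp
  rw [h2, ← ENNReal.ofReal_mul (by norm_num), EReal.coe_ennreal_ofReal, max_eq_left]
  · rfl
  · exact mul_nonneg (by norm_num) (integral_nonneg fun _ => norm_nonneg _)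

lemma energy_of_not_integrable_grad {u : Lp ℝ 2 ν} (h : ¬ Integrable (grad u) (ν ⊗ₘ m)) :
    energy m ν u = ⊤ := by
  have hm := measurable_grad (Lp.stronglyMeasurable u).measurable
  have : ∫⁻ p, ‖grad u p‖ₑ ∂(ν ⊗ₘ m) = ∞ := by
    by_contra h'
    exact h ⟨hm.aestronglyMeasurable, lt_top_iff_ne_top.2 h'⟩
  rw [energy, totalVariation_eq_lintegral_grad (Lp.stronglyMeasurable u).measurable, this,
    ENNReal.mul_top (by simp)]
  rfl

lemma integrable_grad_of_energy_eq_coe {u : Lp ℝ 2 ν} {r : ℝ} (h : energy m ν u = r) :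
    Integrable (grad u) (ν ⊗ₘ m) := by
  by_contra h'
  rw [energy_of_not_integrable_grad h'] at h
  exact EReal.top_ne_coe r h

lemma energy_eq_coe_iff {u : Lp ℝ 2 ν} {r : ℝ} :
    energy m ν u = r ↔
      Integrable (grad u) (ν ⊗ₘ m) ∧ (1 / 2) * ∫ p, |grad u p| ∂(ν ⊗ₘ m) = r := by
  refine ⟨fun h => ⟨integrable_grad_of_energy_eq_coe h, ?_⟩, fun ⟨h, h'⟩ => ?_⟩
  · rw [energy_of_integrable_grad (integrable_grad_of_energy_eq_coe h)] at h
    exact_mod_cast h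
  · rw [energy_of_integrable_grad h, h']

lemma aestronglyMeasurable_grad (hν : m.IsReversible ν) {w : X → ℝ}
    (hw : AEStronglyMeasurable w ν) : AEStronglyMeasurable (grad w) (ν ⊗ₘ m) :=
  (hw.comp_measurePreserving (measurePreserving_snd_compProd hν)).sub
    (hw.comp_measurePreserving (measurePreserving_fst_compProd m ν))

/-- Both marginals of `ν ⊗ₘ m` are ν, so a ν-null set pulls back to a null set along either
coordinate. -/
lemma grad_congr_ae (hν : m.IsReversible ν) {w w' : X → ℝ} (h : w =ᵐ[ν] w') :
    grad w =ᵐ[ν ⊗ₘ m] grad w' := by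
  filter_upwards [(measurePreserving_snd_compProd hν).quasiMeasurePreserving.ae h,
    (measurePreserving_fst_compProd m ν).quasiMeasurePreserving.ae h] with p h1 h2
  simp only [grad, h1, h2]

lemma integrable_grad (hν : m.IsReversible ν) {w : X → ℝ} (hw : Integrable w ν) :
    Integrable (grad w) (ν ⊗ₘ m) :=
  ((measurePreserving_snd_compProd hν).integrable_comp_of_integrable hw).sub
    ((measurePreserving_fst_compProd m ν).integrable_comp_of_integrable hw)

end Energy

/-! ### Green's formula. -/

section Green

variable {z : X × X → ℝ}

lemma integrable_mul_of_ae_bound {Y : Type*} [MeasurableSpace Y] {μ : Measure Y} {f z : Y → ℝ}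
    (hf : Integrable f μ) (hz : AEStronglyMeasurable z μ) (hz1 : ∀ᵐ p ∂μ, ‖z p‖ ≤ 1) :
    Integrable (fun p => f p * z p) μ := by
  simpa only [mul_comm] using hf.bdd_mul hz hz1

/-- Integration by parts against an integrable function. -/
lemma integral_grad_mul_of_integrable (hν : m.IsReversible ν)
    (hz : AEStronglyMeasurable z (ν ⊗ₘ m)) (hz1 : ∀ᵐ p ∂(ν ⊗ₘ m), ‖z p‖ ≤ 1)
    {w : X → ℝ} (hw : Integrable w ν) :
    (1 / 2) * ∫ p, grad w p * z p ∂(ν ⊗ₘ m) = - ∫ x, w x * divergence m z x ∂ν := by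
  have hsw := measurePreserving_swap_compProd hν
  have hzs : AEStronglyMeasurable (fun p : X × X => z p.swap) (ν ⊗ₘ m) :=
    hz.comp_measurePreserving hsw
  have hzs1 : ∀ᵐ p ∂(ν ⊗ₘ m), ‖z p.swap‖ ≤ 1 := hsw.quasiMeasurePreserving.ae hz1
  have hw1 : Integrable (fun p : X × X => w p.1) (ν ⊗ₘ m) :=
    (measurePreserving_fst_compProd m ν).integrable_comp_of_integrable hw
  have hw2 : Integrable (fun p : X × X => w p.2) (ν ⊗ₘ m) :=
    (measurePreserving_snd_compProd hν).integrable_comp_of_integrable hw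
  have i1 := integrable_mul_of_ae_bound hw1 hz hz1
  have i1s := integrable_mul_of_ae_bound hw1 hzs hzs1
  have i2 := integrable_mul_of_ae_bound hw2 hz hz1
  -- Swap invariance moves w to the first coordinate at the price of swapping z.
  have hswap : ∫ p, w p.2 * z p ∂(ν ⊗ₘ m) = ∫ p, w p.1 * z p.swap ∂(ν ⊗ₘ m) := by
    rw [← hsw.integral_comp MeasurableEquiv.prodComm.measurableEmbedding
      (fun p => w p.2 * z p)]
    simp
  have h1 : ∫ p, grad w p * z p ∂(ν ⊗ₘ m)
      = - ∫ p, w p.1 * (z p - z p.swap) ∂(ν ⊗ₘ m) := by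
    simp only [grad, sub_mul, mul_sub]
    rw [integral_sub i2 i1, integral_sub i1 i1s, hswap]
    ring
  have h2 : Integrable (fun p : X × X => w p.1 * (z p - z p.swap)) (ν ⊗ₘ m) := by
    simp only [mul_sub]
    exact i1.sub i1s
  rw [h1, Measure.integral_compProd h2, mul_neg, ← integral_const_mul]
  congr 1
  refine integral_congr_ae (.of_forall fun x => ?_)
  simp only [divergence, integral_const_mul, Prod.swap_prod_mk]
  ring

/-- Fubini suffices, with no integrability of div z assumed. With w an indicator, this makes div z
integrable on sets of finite measure. -/
lemma integrable_mul_divergence (hν : m.IsReversible ν)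
    (hz : AEStronglyMeasurable z (ν ⊗ₘ m)) (hz1 : ∀ᵐ p ∂(ν ⊗ₘ m), ‖z p‖ ≤ 1)
    {w : X → ℝ} (hw : Integrable w ν) :
    Integrable (fun x => w x * divergence m z x) ν := by
  have hsw := measurePreserving_swap_compProd hν
  have hw1 : Integrable (fun p : X × X => w p.1) (ν ⊗ₘ m) :=
    (measurePreserving_fst_compProd m ν).integrable_comp_of_integrable hw
  have h1 := (integrable_mul_of_ae_bound hw1 hz hz1).sub (integrable_mul_of_ae_bound hw1
    (hz.comp_measurePreserving hsw) (hsw.quasiMeasurePreserving.ae hz1))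
  have h2 : Integrable (fun x => ∫ y, (w x * z (x, y) - w x * z (y, x)) ∂(m x)) ν :=
    Integrable.integral_compProd h1
  refine (h2.const_mul (1 / 2)).congr (.of_forall fun x => ?_)
  simp only [divergence, ← mul_sub, integral_const_mul]
  ring

/-- Integration by parts against a square integrable function of finite total variation. -/
lemma integral_grad_mul (hν : m.IsReversible ν)
    (hz : AEStronglyMeasurable z (ν ⊗ₘ m)) (hz1 : ∀ᵐ p ∂(ν ⊗ₘ m), ‖z p‖ ≤ 1)
    (hdiv : MemLp (divergence m z) 2 ν) {w : X → ℝ} (hw : MemLp w 2 ν)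
    (hgw : Integrable (grad w) (ν ⊗ₘ m)) :
    (1 / 2) * ∫ p, grad w p * z p ∂(ν ⊗ₘ m) = - ∫ x, w x * divergence m z x ∂ν := by
  let S : ℕ → X → ℝ := fun n x => softThreshold (1 / ((n : ℝ) + 1)) (w x)
  have hS : ∀ n, Integrable (S n) ν := fun n => integrable_softThreshold Nat.one_div_pos_of_nat hw
  have h1 : Filter.Tendsto (fun n => (1 / 2) * ∫ p, grad (S n) p * z p ∂(ν ⊗ₘ m)) Filter.atTop
      (nhds ((1 / 2) * ∫ p, grad w p * z p ∂(ν ⊗ₘ m))) := by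
    -- Thresholding is 1-Lipschitz, so |grad w| dominates the gradients of all the approximants.
    refine Filter.Tendsto.const_mul _ ?_
    refine tendsto_integral_of_dominated_convergence (fun p => |grad w p|)
      (fun n => (aestronglyMeasurable_grad hν (hS n).1).mul hz) hgw.abs (fun n => ?_)
      (.of_forall fun p => ?_)
    · filter_upwards [hz1] with p hp
      rw [norm_mul]
      refine (mul_le_of_le_one_right (norm_nonneg _) hp).trans ?_
      exact abs_softThreshold_sub_le Nat.one_div_pos_of_nat _ _
    · exact ((tendsto_softThreshold (w p.2)).sub (tendsto_softThreshold (w p.1))).mul_const _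
  have h2 := (tendsto_integral_mul_softThreshold hdiv hw).neg
  refine tendsto_nhds_unique h1 (h2.congr fun n => ?_)
  exact (integral_grad_mul_of_integrable hν hz hz1 (hS n)).symm

/-- The integration by parts formula in terms of `v = -div z`. -/
lemma integral_mul_eq_of_divergence (hν : m.IsReversible ν)
    (hz : AEStronglyMeasurable z (ν ⊗ₘ m)) (hz1 : ∀ᵐ p ∂(ν ⊗ₘ m), ‖z p‖ ≤ 1)
    {v : X → ℝ} (hv : MemLp v 2 ν) (hvz : ∀ᵐ x ∂ν, v x = - divergence m z x)
    {w : X → ℝ} (hw : MemLp w 2 ν) (hgw : Integrable (grad w) (ν ⊗ₘ m)) :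
    ∫ x, w x * v x ∂ν = (1 / 2) * ∫ p, grad w p * z p ∂(ν ⊗ₘ m) := by
  have hdiv : MemLp (divergence m z) 2 ν := by
    refine hv.neg.ae_eq ?_
    filter_upwards [hvz] with x hx
    simp [hx]
  rw [integral_grad_mul hν hz hz1 hdiv hw hgw, ← integral_neg]
  refine integral_congr_ae ?_
  filter_upwards [hvz] with x hx
  rw [hx, mul_neg]

/-- If `z` is almost everywhere a sign of `grad u` and `div z` is square integrable, then `u` has
finite total variation. -/
lemma integrable_grad_of_mul_eq_abs (hν : m.IsReversible ν)
    (hz : AEStronglyMeasurable z (ν ⊗ₘ m)) (hz1 : ∀ᵐ p ∂(ν ⊗ₘ m), ‖z p‖ ≤ 1)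
    (hdiv : MemLp (divergence m z) 2 ν) {w : X → ℝ} (hw : MemLp w 2 ν)
    (hsign : ∀ᵐ p ∂(ν ⊗ₘ m), grad w p * z p = |grad w p|) :
    Integrable (grad w) (ν ⊗ₘ m) := by
  let S : ℕ → X → ℝ := fun n x => softThreshold (1 / ((n : ℝ) + 1)) (w x)
  have hS : ∀ n, Integrable (S n) ν := fun n => integrable_softThreshold Nat.one_div_pos_of_nat hw
  have hlim := ((tendsto_integral_mul_softThreshold hdiv hw).neg.const_mul 2)
  have hval : ∀ n, ∫⁻ p, ‖grad (S n) p‖ₑ ∂(ν ⊗ₘ m)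
      = ENNReal.ofReal (2 * - ∫ x, S n x * divergence m z x ∂ν) := by
    intro n
    rw [← ofReal_integral_norm_eq_lintegral_enorm (integrable_grad hν (hS n)),
      ← integral_grad_mul_of_integrable hν hz hz1 (hS n)]
    congr 1
    rw [← mul_assoc, show (2 : ℝ) * (1 / 2) = 1 by norm_num, one_mul]
    refine integral_congr_ae ?_
    -- Thresholding is monotone, so z, which is the exact sign of grad w where that is nonzero, is
    -- also a sign of grad (S n).
    filter_upwards [hsign] with p hp
    have hε : (0 : ℝ) < 1 / ((n : ℝ) + 1) := Nat.one_div_pos_of_nat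
    simp only [grad, S, Real.norm_eq_abs] at hp ⊢
    rcases lt_trichotomy (w p.1) (w p.2) with h | h | h
    · rw [abs_of_pos (sub_pos.2 h)] at hp
      rw [abs_of_nonneg (sub_nonneg.2 (softThreshold_mono hε h.le)),
        (mul_eq_left₀ (sub_pos.2 h).ne').1 hp, mul_one]
    · simp [h]
    · rw [abs_of_neg (sub_neg.2 h), ← mul_neg_one] at hp
      rw [abs_of_nonpos (sub_nonpos.2 (softThreshold_mono hε h.le)),
        mul_left_cancel₀ (sub_neg.2 h).ne hp, mul_neg_one]
  refine ⟨aestronglyMeasurable_grad hν hw.1, ?_⟩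
  have hpt : ∀ p, ‖grad w p‖ₑ = Filter.liminf (fun n => ‖grad (S n) p‖ₑ) Filter.atTop := fun p =>
    ((tendsto_softThreshold (w p.2)).sub (tendsto_softThreshold (w p.1))).enorm.liminf_eq.symm
  rw [HasFiniteIntegral]
  simp only [hpt]
  -- Fatou: the integrals on the right converge to a finite limit because w and div z are both in
  -- L².
  refine (lintegral_liminf_le' fun n =>
    (aestronglyMeasurable_grad hν (hS n).1).enorm).trans_lt ?_
  simp only [hval]
  exact (ENNReal.tendsto_ofReal hlim).liminf_eq.trans_lt ENNReal.ofReal_lt_top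

end Green

/-! ### Subgradients and divergences. -/

section Subdifferential

/-- Green's formula and |z| ≤ 1 give ⟨v, w⟩ ≤ energy w when the latter is finite; subtracting the
equality at u gives the subgradient inequality. -/
lemma mem_subdifferential_of_divergence (hν : m.IsReversible ν) {z : X × X → ℝ}
    (hz : AEStronglyMeasurable z (ν ⊗ₘ m)) (hz1 : ∀ᵐ p ∂(ν ⊗ₘ m), ‖z p‖ ≤ 1)
    {u v : Lp ℝ 2 ν} (hvz : ∀ᵐ x ∂ν, v x = - divergence m z x)
    (huv : ((∫ x, u x * v x ∂ν : ℝ) : EReal) = energy m ν u) :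
    v ∈ subdifferential (energy m ν) u := by
  have hinner : ∀ w : Lp ℝ 2 ν, inner ℝ v w = ∫ x, w x * v x ∂ν := fun w => by
    rw [L2.inner_def]; simp
  intro w
  by_cases hw : Integrable (grad w) (ν ⊗ₘ m)
  · rw [← huv, energy_of_integrable_grad hw, inner_sub_right, hinner, hinner,
      integral_mul_eq_of_divergence hν hz hz1 (Lp.memLp v) hvz (Lp.memLp w) hw]
    rw [← EReal.coe_add, EReal.coe_le_coe_iff, add_sub_cancel]
    refine mul_le_mul_of_nonneg_left ?_ (by norm_num)
    refine integral_mono_ae (integrable_mul_of_ae_bound hw hz hz1) hw.abs ?_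
    filter_upwards [hz1] with p hp
    refine (le_abs_self _).trans ?_
    rw [abs_mul]
    exact mul_le_of_le_one_right (abs_nonneg _) hp
  · rw [energy_of_not_integrable_grad hw]
    exact le_top

lemma energy_toLp (hν : m.IsReversible ν) {w : X → ℝ} (hw : MemLp w 2 ν)
    (hgw : Integrable (grad w) (ν ⊗ₘ m)) :
    energy m ν hw.toLp = (((1 / 2) * ∫ p, |grad w p| ∂(ν ⊗ₘ m) : ℝ) : EReal) := by
  have h := grad_congr_ae hν hw.coeFn_toLp
  rw [energy_of_integrable_grad (hgw.congr h.symm),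
    integral_congr_ae (h.mono fun p hp => congrArg abs hp)]

lemma energy_zero (hν : m.IsReversible ν) : energy m ν (0 : Lp ℝ 2 ν) = 0 := by
  have h0 : grad (0 : X → ℝ) = 0 := by
    funext p
    simp [grad]
  have h := energy_toLp hν (MemLp.zero (p := 2) (ε := ℝ) (μ := ν))
    (by rw [h0]; exact integrable_zero _ _ _)
  rw [h0] at h
  simpa using h

lemma energy_two_smul (hν : m.IsReversible ν) {u : Lp ℝ 2 ν} {r : ℝ} (hu : energy m ν u = r) :
    energy m ν ((2 : ℝ) • u) = ((2 * r : ℝ) : EReal) := by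
  obtain ⟨h1, h2⟩ := energy_eq_coe_iff.1 hu
  have hae : grad ((2 : ℝ) • u : Lp ℝ 2 ν) =ᵐ[ν ⊗ₘ m] fun p => 2 * grad u p := by
    refine (grad_congr_ae hν (Lp.coeFn_smul (2 : ℝ) u)).trans (.of_forall fun p => ?_)
    simp only [grad, Pi.smul_apply, smul_eq_mul]
    ring
  rw [energy_eq_coe_iff]
  refine ⟨(h1.const_mul 2).congr hae.symm, ?_⟩
  rw [integral_congr_ae (hae.mono fun p hp => congrArg abs hp), ← h2]
  simp only [abs_mul, abs_two, integral_const_mul]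
  ring

/-- Elements of the subdifferential of the (positively homogeneous) energy. -/
lemma of_mem_subdifferential_energy (hν : m.IsReversible ν) {u v : Lp ℝ 2 ν}
    (h : v ∈ subdifferential (energy m ν) u) :
    energy m ν u = ((inner ℝ v u : ℝ) : EReal) ∧
      ∀ w : Lp ℝ 2 ν, ((inner ℝ v w : ℝ) : EReal) ≤ energy m ν w := by
  have hfin : ∃ r : ℝ, energy m ν u = r := by
    by_cases hu : Integrable (grad u) (ν ⊗ₘ m)
    · exact ⟨_, energy_of_integrable_grad hu⟩
    · have h0 := h 0
      rw [energy_zero hν, energy_of_not_integrable_grad hu, EReal.top_add_coe] at h0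
      exact absurd h0 (by simp)
  obtain ⟨r, hr⟩ := hfin
  -- Testing with 0 gives r ≤ ⟨v, u⟩; testing with 2u gives the reverse inequality.
  have h0 := h 0
  have h2 := h ((2 : ℝ) • u)
  rw [energy_zero hν, hr, ← EReal.coe_add, ← EReal.coe_zero, EReal.coe_le_coe_iff, zero_sub,
    inner_neg_right] at h0
  rw [energy_two_smul hν hr, hr, ← EReal.coe_add, EReal.coe_le_coe_iff, inner_sub_right,
    inner_smul_right] at h2
  have hru : r = inner ℝ v u := by linarith
  refine ⟨by rw [hr, hru], fun w => ?_⟩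
  have hw := h w
  rwa [hr, ← EReal.coe_add, inner_sub_right, hru, add_sub_cancel] at hw

/-- A functional dominated by `C ‖G ·‖` factors through `G` with norm at most `C`. -/
lemma exists_factor_of_abs_le {W F : Type*} [AddCommGroup W] [Module ℝ W] [NormedAddCommGroup F]
    [NormedSpace ℝ F] (G : W →ₗ[ℝ] F) (V : W →ₗ[ℝ] ℝ) {C : ℝ} (hC : 0 ≤ C)
    (hVG : ∀ w, |V w| ≤ C * ‖G w‖) :
    ∃ ℓ : F →L[ℝ] ℝ, ‖ℓ‖ ≤ C ∧ ∀ w, ℓ (G w) = V w := by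
  -- A linear section s of G carries V to the range of G. The choice is harmless: s (G w) and w
  -- differ by an element of ker G, where V vanishes by `hVG`.
  obtain ⟨s, hs⟩ := G.rangeRestrict.exists_rightInverse_of_surjective
    (LinearMap.range_eq_top.2 G.surjective_rangeRestrict)
  have hGs : ∀ y : LinearMap.range G, G (s y) = y := fun y =>
    congrArg Subtype.val (LinearMap.congr_fun hs y)
  have hb : ∀ y, ‖(V ∘ₗ s) y‖ ≤ C * ‖y‖ := fun y => by
    have := hVG (s y)
    rw [hGs] at this
    exact this
  obtain ⟨ℓ, hℓ, hℓn⟩ := exists_extension_norm_eq (LinearMap.range G)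
    ((V ∘ₗ s).mkContinuous C hb)
  refine ⟨ℓ, hℓn.trans_le (LinearMap.mkContinuous_norm_le _ hC _), fun w => ?_⟩
  have h1 : ℓ (G w) = V (s ⟨G w, w, rfl⟩) := hℓ ⟨G w, w, rfl⟩
  have h2 : |V (s ⟨G w, w, rfl⟩ - w)| ≤ 0 := by
    refine (hVG _).trans ?_
    rw [map_sub, hGs]
    simp
  rw [abs_nonpos_iff, map_sub, sub_eq_zero] at h2
  rw [h1, h2]

/-- The subspace of test functions used in the duality argument. -/
def testFunctions (ν : Measure X) : Submodule ℝ (X → ℝ) where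
  -- Integrability puts the gradient in L¹; square integrability makes the pairing with v finite.
  carrier := {w | Integrable w ν ∧ MemLp w 2 ν}
  add_mem' ha hb := ⟨ha.1.add hb.1, ha.2.add hb.2⟩
  zero_mem' := ⟨integrable_zero _ _ _, MemLp.zero⟩
  smul_mem' c _ ha := ⟨ha.1.smul c, ha.2.const_smul c⟩

/-- A functional dominated by the total variation is a divergence. -/
theorem exists_divergence_eq (hν : m.IsReversible ν) {v : X → ℝ} (hv : MemLp v 2 ν)
    (hle : ∀ w : X → ℝ, Integrable w ν → MemLp w 2 ν →
      ∫ x, w x * v x ∂ν ≤ (1 / 2) * ∫ p, |grad w p| ∂(ν ⊗ₘ m)) :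
    ∃ z : X × X → ℝ, AEStronglyMeasurable z (ν ⊗ₘ m) ∧ (∀ᵐ p ∂(ν ⊗ₘ m), ‖z p‖ ≤ 1) ∧
      ∀ᵐ x ∂ν, v x = - divergence m z x := by
  have := sigmaFinite_compProd m ν
  let G : testFunctions ν →ₗ[ℝ] Lp ℝ 1 (ν ⊗ₘ m) :=
    { toFun := fun w => (integrable_grad hν w.2.1).toL1
      map_add' := fun a b => by
        rw [← Integrable.toL1_add]
        congr 1
        funext p
        simp only [grad, Submodule.coe_add, Pi.add_apply]
        ring
      map_smul' := fun c a => by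
        rw [RingHom.id_apply, ← Integrable.toL1_smul]
        congr 1
        funext p
        simp only [grad, Submodule.coe_smul, Pi.smul_apply, smul_eq_mul]
        ring }
  let V : testFunctions ν →ₗ[ℝ] ℝ :=
    { toFun := fun w => ∫ x, w.1 x * v x ∂ν
      map_add' := fun a b => by
        simp only [Submodule.coe_add, Pi.add_apply, add_mul]
        exact integral_add (a.2.2.integrable_mul hv) (b.2.2.integrable_mul hv)
      map_smul' := fun c a => by
        simp only [Submodule.coe_smul, Pi.smul_apply, smul_eq_mul, mul_assoc, integral_const_mul,
          RingHom.id_apply] }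
  have hVle : ∀ w, V w ≤ (1 / 2) * ‖G w‖ := by
    intro w
    have h1 : ‖G w‖ = ∫ p, |grad w.1 p| ∂(ν ⊗ₘ m) := 
      L1.norm_of_fun_eq_integral_norm (integrable_grad hν w.2.1)
    rw [h1]
    exact hle w.1 w.2.1 w.2.2
  have hVG : ∀ w, |V w| ≤ (1 / 2) * ‖G w‖ := by
    intro w
    refine abs_le'.2 ⟨hVle w, ?_⟩
    simpa using hVle (-w)
  obtain ⟨ℓ, hℓle, hℓG⟩ := exists_factor_of_abs_le G V (by norm_num) hVG
  obtain ⟨g, hgm, hgb, hg⟩ := exists_bounded_representation ℓ hℓle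
  -- The factor 2 cancels the 1/2 in the energy, turning |g| ≤ 1/2 into |z| ≤ 1.
  have hzm : AEStronglyMeasurable (fun p => 2 * g p) (ν ⊗ₘ m) := hgm.const_mul 2
  have hz1 : ∀ᵐ p ∂(ν ⊗ₘ m), ‖2 * g p‖ ≤ 1 := by
    filter_upwards [hgb] with p hp
    rw [Real.norm_eq_abs, abs_mul, abs_two]
    linarith
  refine ⟨fun p => 2 * g p, hzm, hz1, ?_⟩
  have hkey : ∀ w : X → ℝ, Integrable w ν → MemLp w 2 ν →
      ∫ x, w x * v x ∂ν = - ∫ x, w x * divergence m (fun p => 2 * g p) x ∂ν := by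
    intro w hw hw2
    rw [← integral_grad_mul_of_integrable hν hzm hz1 hw]
    have h1 : V ⟨w, hw, hw2⟩ = _ := (hℓG ⟨w, hw, hw2⟩).symm.trans (hg _ (integrable_grad hν hw))
    refine h1.trans ?_
    rw [← integral_const_mul]
    congr 1
    funext p
    ring
  have hind : ∀ (A : Set X) (f : X → ℝ),
      (fun x => A.indicator (1 : X → ℝ) x * f x) = A.indicator f := by
    intro A f
    funext x
    by_cases hx : x ∈ A <;> simp [hx]
  have h1i : ∀ {A : Set X}, MeasurableSet A → ν A < ∞ → MemLp (A.indicator (1 : X → ℝ)) 2 ν :=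
    fun hA hνA => memLp_indicator_const 2 hA 1 (Or.inr hνA.ne)
  have h1i' : ∀ {A : Set X}, MeasurableSet A → ν A < ∞ →
      Integrable (A.indicator (1 : X → ℝ)) ν :=
    fun hA hνA => memLp_one_iff_integrable.1 (memLp_indicator_const 1 hA 1 (Or.inr hνA.ne))
  -- Indicators of sets of finite measure are admissible test functions and determine v.
  refine ae_eq_of_forall_setIntegral_eq_of_sigmaFinite (fun A hA hνA => ?_) (fun A hA hνA => ?_)
    (fun A hA hνA => ?_)
  · rw [← integrable_indicator_iff hA, ← hind A]
    exact (h1i hA hνA).integrable_mul hv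
  · refine Integrable.neg (f := divergence m fun p => 2 * g p) ?_
    have := integrable_mul_divergence hν hzm hz1 (h1i' hA hνA)
    rw [hind A, integrable_indicator_iff hA] at this
    exact this
  · have := hkey _ (h1i' hA hνA) (h1i hA hνA)
    rw [hind A, hind A, integral_indicator hA, integral_indicator hA] at this
    rw [this, integral_neg]

end Subdifferential

end RandomWalkTV

/-! ### Antisymmetric fields. -/

namespace RandomWalkTV

variable {X : Type*} [MeasurableSpace X] {m : Kernel X X} {ν : Measure X}

/-- The antisymmetric part of a vector field. -/
noncomputable def antisymmPart (z : X × X → ℝ) (p : X × X) : ℝ := (1 / 2) * (z p - z p.swap)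

lemma integral_antisymmPart (z : X × X → ℝ) (x : X) :
    ∫ y, antisymmPart z (x, y) ∂(m x) = divergence m z x := by
  simp only [antisymmPart, divergence, integral_const_mul, Prod.swap_prod_mk]

lemma isAntisymmetric_antisymmPart (z : X × X → ℝ) : IsAntisymmetric m ν (antisymmPart z) := by
  refine .of_forall fun p => ?_
  simp only [antisymmPart, Prod.swap]
  ring

lemma memVectorField_of_divergence {z : X × X → ℝ} (hz : MemLp z ∞ (ν ⊗ₘ m)) {v : X → ℝ}
    (hv : MemLp v 2 ν) (hvz : ∀ᵐ x ∂ν, v x = - divergence m z x) : MemVectorField m ν 2 z := by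
  refine ⟨hz, hv.neg.ae_eq ?_⟩
  filter_upwards [hvz] with x hx
  simp [hx]

variable [IsMarkovKernel m] [SigmaFinite ν]

lemma divergence_of_isAntisymmetric {g : X × X → ℝ} (hg : IsAntisymmetric m ν g) :
    ∀ᵐ x ∂ν, divergence m g x = ∫ y, g (x, y) ∂(m x) := by
  filter_upwards [Measure.ae_ae_of_ae_compProd hg] with x hx
  rw [divergence, ← integral_const_mul]
  refine integral_congr_ae ?_
  filter_upwards [hx] with y hy
  rw [hy]
  ring

lemma antisymmPart_bound (hν : m.IsReversible ν) {z : X × X → ℝ}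
    (hz : AEStronglyMeasurable z (ν ⊗ₘ m) ∧ ∀ᵐ p ∂(ν ⊗ₘ m), ‖z p‖ ≤ 1) :
    AEStronglyMeasurable (antisymmPart z) (ν ⊗ₘ m) ∧
      ∀ᵐ p ∂(ν ⊗ₘ m), ‖antisymmPart z p‖ ≤ 1 := by
  have hsw := measurePreserving_swap_compProd hν
  refine ⟨(hz.1.sub (hz.1.comp_measurePreserving hsw)).const_mul _, ?_⟩
  filter_upwards [hz.2, hsw.quasiMeasurePreserving.ae hz.2] with p h1 h2
  simp only [antisymmPart, Real.norm_eq_abs, abs_le] at *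
  constructor <;> linarith

end RandomWalkTV

/-! ### The equivalences. -/

open RandomWalkTV in
theorem theorem3p3 {X : Type*} [MetricSpace X] [CompleteSpace X] [SecondCountableTopology X]
    [MeasurableSpace X] [BorelSpace X]
    (m : Kernel X X) [IsMarkovKernel m]
    (ν : Measure X) [SigmaFinite ν] (hν : m.IsReversible ν)
    (u v : Lp ℝ 2 ν) :
    List.TFAE [
      -- (i)
      v ∈ subdifferential (energy m ν) u,
      -- (ii)
      ∃ z : X × X → ℝ, MemVectorField m ν 2 z ∧ eLpNorm z ∞ (ν ⊗ₘ m) ≤ 1 ∧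
        (∀ᵐ x ∂ν, v x = - divergence m z x) ∧
        ((∫ x, u x * v x ∂ν : ℝ) : EReal) = energy m ν u,
      -- (iii)
      ∃ z : X × X → ℝ, MemVectorField m ν 2 z ∧ eLpNorm z ∞ (ν ⊗ₘ m) ≤ 1 ∧
        (∀ᵐ x ∂ν, v x = - divergence m z x) ∧
        energy m ν u = (((1 / 2) * ∫ p, grad u p * z p ∂(ν ⊗ₘ m) : ℝ) : EReal),
      -- (iv)
      ∃ g : X × X → ℝ, MemLp g ∞ (ν ⊗ₘ m) ∧ IsAntisymmetric m ν g ∧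
        eLpNorm g ∞ (ν ⊗ₘ m) ≤ 1 ∧
        (∀ᵐ x ∂ν, - ∫ y, g (x, y) ∂(m x) = v x) ∧
        ((- ∫ x, (∫ y, g (x, y) ∂(m x)) * u x ∂ν : ℝ) : EReal) = energy m ν u,
      -- (v)
      ∃ g : X × X → ℝ, MemLp g ∞ (ν ⊗ₘ m) ∧ IsAntisymmetric m ν g ∧
        eLpNorm g ∞ (ν ⊗ₘ m) ≤ 1 ∧
        (∀ᵐ x ∂ν, - ∫ y, g (x, y) ∂(m x) = v x) ∧
        (∀ᵐ p ∂(ν ⊗ₘ m), g p ∈ multiSign (u p.2 - u p.1))] := by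
  have hu2 := Lp.memLp u
  have hv2 := Lp.memLp v
  tfae_have 1 → 2 := by
    intro h
    obtain ⟨h1, h2⟩ := of_mem_subdifferential_energy hν h
    obtain ⟨z, hzm, hz1, hvz⟩ := exists_divergence_eq hν hv2 fun w hw hw2 => by
      have h3 := h2 hw2.toLp
      rw [energy_toLp hν hw2 (integrable_grad hν hw), EReal.coe_le_coe_iff, L2.inner_def] at h3
      refine le_of_eq_of_le (integral_congr_ae ?_) h3
      filter_upwards [hw2.coeFn_toLp] with x hx
      simp [hx]
    obtain ⟨hz, hzn⟩ := memLp_top_and_eLpNorm_le_one_iff.2 ⟨hzm, hz1⟩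
    refine ⟨z, memVectorField_of_divergence hz hv2 hvz, hzn, hvz, ?_⟩
    rw [h1, L2.inner_def]
    simp
  tfae_have 2 → 1 := by
    rintro ⟨z, hz, hzn, hvz, huv⟩
    obtain ⟨hzm, hz1⟩ := memLp_top_and_eLpNorm_le_one_iff.1 ⟨hz.1, hzn⟩
    exact mem_subdifferential_of_divergence hν hzm hz1 hvz huv
  -- The same z serves both ways: each assertion equates the energy with a real number, so the
  -- energy is finite and Green's formula applies to u.
  tfae_have 2 ↔ 3 := by
    refine exists_congr fun z => and_congr_right fun hz => and_congr_right fun hzn =>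
      and_congr_right fun hvz => ?_
    obtain ⟨hzm, hz1⟩ := memLp_top_and_eLpNorm_le_one_iff.1 ⟨hz.1, hzn⟩
    have key := fun hgu => integral_mul_eq_of_divergence hν hzm hz1 hv2 hvz hu2 hgu
    constructor
    · intro h
      rw [← h, key (integrable_grad_of_energy_eq_coe h.symm)]
    · intro h
      rw [h, key (integrable_grad_of_energy_eq_coe h)]
  tfae_have 2 → 4 := by
    rintro ⟨z, hz, hzn, hvz, huv⟩
    obtain ⟨hg, hgn⟩ := memLp_top_and_eLpNorm_le_one_iff.2
      (antisymmPart_bound hν (memLp_top_and_eLpNorm_le_one_iff.1 ⟨hz.1, hzn⟩))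
    refine ⟨antisymmPart z, hg, isAntisymmetric_antisymmPart z, hgn, ?_, ?_⟩
    · filter_upwards [hvz] with x hx
      rw [integral_antisymmPart, hx]
    · rw [← huv, ← integral_neg]
      congr 1
      refine integral_congr_ae ?_
      filter_upwards [hvz] with x hx
      rw [integral_antisymmPart, hx]
      ring
  tfae_have 4 → 2 := by
    rintro ⟨g, hg, hga, hgn, hgv, hgu⟩
    have hvz : ∀ᵐ x ∂ν, v x = - divergence m g x := by
      filter_upwards [hgv, divergence_of_isAntisymmetric hga] with x h1 h2
      rw [h2, h1]
    refine ⟨g, memVectorField_of_divergence hg hv2 hvz, hgn, hvz, ?_⟩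
    rw [← hgu, ← integral_neg]
    congr 1
    refine integral_congr_ae ?_
    filter_upwards [hgv] with x hx
    rw [← hx]
    ring
  tfae_have 4 ↔ 5 := by
    refine exists_congr fun g => and_congr_right fun hg => and_congr_right fun hga =>
      and_congr_right fun hgn => and_congr_right fun hgv => ?_
    obtain ⟨hgm, hg1⟩ := memLp_top_and_eLpNorm_le_one_iff.1 ⟨hg, hgn⟩
    have hvz : ∀ᵐ x ∂ν, v x = - divergence m g x := by
      filter_upwards [hgv, divergence_of_isAntisymmetric hga] with x h1 h2
      rw [h2, h1]
    have hdiv := (memVectorField_of_divergence hg hv2 hvz).2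
    have key := fun hgu => integral_mul_eq_of_divergence hν hgm hg1 hv2 hvz hu2 hgu
    have hint : - ∫ x, (∫ y, g (x, y) ∂(m x)) * u x ∂ν = ∫ x, u x * v x ∂ν := by
      rw [← integral_neg]
      refine integral_congr_ae ?_
      filter_upwards [hgv] with x hx
      rw [← hx]
      ring
    rw [hint, eq_comm, energy_eq_coe_iff]
    constructor
    · rintro ⟨hgu, heq⟩
      have hi := integrable_mul_of_ae_bound hgu hgm hg1
      -- A nonnegative integrand with zero integral vanishes almost everywhere.
      have h0 : ∫ p, (|grad u p| - grad u p * g p) ∂(ν ⊗ₘ m) = 0 := by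
        rw [integral_sub hgu.abs hi]
        rw [key hgu] at heq
        linarith
      have hnn : 0 ≤ᵐ[ν ⊗ₘ m] fun p => |grad u p| - grad u p * g p := by
        filter_upwards [hg1] with p h2
        refine sub_nonneg.2 ((le_abs_self _).trans ?_)
        rw [abs_mul]
        exact mul_le_of_le_one_right (abs_nonneg _) h2
      filter_upwards [(integral_eq_zero_iff_of_nonneg_ae hnn (hgu.abs.sub hi)).1 h0, hg1]
        with p h1 h2
      exact mem_multiSign_iff.2 ⟨h2, (sub_eq_zero.1 h1).symm⟩
    · intro hs
      have hs' : ∀ᵐ p ∂(ν ⊗ₘ m), grad u p * g p = |grad u p| :=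
        hs.mono fun p hp => (mem_multiSign_iff.1 hp).2
      -- Finite energy must be derived before Green's formula can be applied to u.
      have hgu := integrable_grad_of_mul_eq_abs hν hgm hg1 hdiv hu2 hs'
      refine ⟨hgu, ?_⟩
      rw [key hgu, integral_congr_ae hs']
  tfae_finish
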